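/- Consider the \((N,K,L)\)-multi-access caching network with \(1\le L\le K\le N\): a server holds \(N\) files of \(F\) bits each, there are \(K\) caches of \(MF\) bits each and \(K\) users, and user \(k\) reads the \(L\) consecutive caches \(k,k+1,\dots,k+L-1\) (cyclically modulo \(K\)). In an uncoded placement each cache stores a set of bits of the files, chosen before the requests are known. Then every user requests one file, and the server broadcasts a message, depending on the requests, from which every user recovers its file with the help of the caches that it reads. A pair \((R,M)\) is achievable (with uncoded placement) if for every \(\varepsilon>0\) and all sufficiently large \(F\) there is an uncoded placement with at most \(MF\) bits per cache such that every request profile can be served by a broadcast of at most \((R+\varepsilon)F\) bits. Let \(R^*(M)\) be the infimum of the \(R\) for which \((R,M)\) is achievable. (1) For \(M=iN/K\) with an integer \(0\le i\le\lfloor K/L\rfloor\), the rate \(R_{\rm new}(M)=K\left(1-\frac{LM}{N}\right)^2\) is achievable, so \(R^*(M)\le R_{\rm new}(M)\). (2) For \(M=\lceil K/L\rceil N/K\), the rate \(R_{\rm new}(M)=0\) is achievable, so \(R^*(M)\le 0\). (3) For every real \(M\) with \(0\le M\le\frac NK\lceil K/L\rceil\), the value at \(M\) of the lower convex envelope of the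 points \((M',R_{\rm new}(M'))\) of (1) and (2) is achievable, and is an upper bound for \(R^*(M)\). (4) The rate in (1) is attained as follows. Let \(\hat{\mathcal S}\) be the (nonempty) family of sets \(s\) of \(i\) caches, any two distinct elements \(a,c\) of which satisfy \(|a-c|\ge L\) and \(K-|a-c|\ge L\). Split each file into \(|\hat{\mathcal S}|\) subfiles of \(b\) bits, indexed by \(\hat{\mathcal S}\), and store the subfile of \(s\) in exactly the caches in \(s\). Consider the index coding problem whose nodes are the pairs \((p,s)\) such that user \(p\) reads no cache in \(s\), where node \((p,s)\) requests its own packet and has the packet of node \((q,t)\) as side information if and only if user \(p\) reads a cache in \(t\). Node \(w\ne v\) interferes with node \(v\) if \(v\) does not have the packet of \(w\). This problem has a coloring in which no node shares its color with a node interfering with it and for which the maximum \(m\) over all nodes \(v\) of the number of colors of \(v\) and the nodes interfering with it (\(m=0\) if there are no nodes) satisfies \(m=K\left(1-\frac{LM}{N}\right)^2|\hat{\mathcal S}|\). Moreover, for all sufficiently large \(b\), each cache stores at most \(M|\hat{\mathcal S}|b\) bits, and there is an index code of \(mb\) bits for packets of \(b\) bits, which is a linear function over the field with two elements of the sums of the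 packets of each color, such that for every request profile the broadcast of this code, with the requested subfiles as packets, lets every user recover its file. -/

import Mathlib

namespace MultiAccess

/-! ### The network: `N` files, `K` caches, `K` users, each user reads `L` consecutive caches -/

/-- A bit. -/
abbrev Bit : Type := ZMod 2

/-- The contents of the `N` files; `B` is the set of bit positions of a file. -/
abbrev Library (N : ℕ) (B : Type) : Type := Fin N → B → Bit

/-- The caches read by user `k`: `k, k + 1, …, k + L - 1`, cyclically modulo `K`. -/
def accessible (K L : ℕ) (k : Fin K) : Finset (Fin K) :=
  Finset.univ.filter fun c => ∃ j, j < L ∧ (c : ℕ) = ((k : ℕ) + j) % K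

/-- An uncoded placement: each cache stores a set of bits of the files. -/
abbrev Placement (N K : ℕ) (B : Type) : Type := Fin K → Finset (Fin N × B)

/-- User `k`, reading its `L` caches, knows the file bit `x`. -/
def Knows {N K : ℕ} {B : Type} (L : ℕ) (C : Placement N K B) (k : Fin K) (x : Fin N × B) : Prop :=
  ∃ c ∈ accessible K L k, x ∈ C c

/-- For the request profile `d`, the broadcast of the `r` bits `enc W` lets every user `k` recover
file `d k` from the broadcast and the contents of the caches that it reads. -/
def Serves {N K : ℕ} {B : Type} (L : ℕ) (C : Placement N K B) (d : Fin K → Fin N) {r : ℕ}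
    (enc : Library N B → (Fin r → Bit)) : Prop :=
  ∀ k : Fin K, ∃ dec : (Fin r → Bit) → ({x : Fin N × B // Knows L C k x} → Bit) → (B → Bit),
    ∀ W : Library N B, dec (enc W) (fun x => W x.1.1 x.1.2) = W (d k)

/-- There is an uncoded placement with at most `m` bits in each cache, chosen before the requests
are known, such that every request profile can be served by a broadcast of `r` bits. -/
def HasScheme (N K L : ℕ) (B : Type) (m r : ℕ) : Prop :=
  ∃ C : Placement N K B, (∀ c, (C c).card ≤ m) ∧
    ∀ d : Fin K → Fin N, ∃ enc : Library N B → (Fin r → Bit), Serves L C d enc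

/-- The rate-memory pair `(R, M)` is achievable with uncoded placement: for every `ε > 0` and all
sufficiently large file sizes `F` (in bits), caches of at most `M * F` bits and broadcasts of at
most `(R + ε) * F` bits suffice. -/
def Achievable (N K L : ℕ) (R M : ℝ) : Prop :=
  ∀ ε : ℝ, 0 < ε → ∃ F₀ : ℕ, ∀ F : ℕ, F₀ ≤ F → ∃ m r : ℕ,
    (m : ℝ) ≤ M * F ∧ (r : ℝ) ≤ (R + ε) * F ∧ HasScheme N K L (Fin F) m r

/-- The optimal rate-memory trade-off `R*(M)` under uncoded placement. -/
noncomputable def optimalRate (N K L : ℕ) (M : ℝ) : ℝ := sInf {R : ℝ | Achievable N K L R M}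

/-! ### Corner points and the lower convex envelope -/

/-- The points `(M, R)` with `M = iN/K` and `R = K(1 - LM/N)²` for `0 ≤ i ≤ ⌊K/L⌋`, together with
`(⌈K/L⌉N/K, 0)`. -/
def cornerPoints (N K L : ℕ) : Set (ℝ × ℝ) :=
  {p | ∃ i : ℕ, i ≤ ⌊(K : ℝ) / L⌋₊ ∧ p.1 = (i : ℝ) * N / K ∧ p.2 = K * (1 - L * p.1 / N) ^ 2} ∪
    {((⌈(K : ℝ) / L⌉₊ : ℝ) * N / K, 0)}

/-- The lower convex envelope of a set of points of the plane, as a function of the abscissa. -/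
noncomputable def lowerConvexEnvelope (P : Set (ℝ × ℝ)) (x : ℝ) : ℝ :=
  sInf {y : ℝ | (x, y) ∈ convexHull ℝ P}

/-! ### Index coding -/

/-- An index coding problem with node set `V`: node `v` requests packet `v` and has the packets
`w` with `has v w`, none of them its own, as side information. -/
structure IndexCodingProblem (V : Type) where
  has : V → V → Prop
  irrefl : ∀ v, ¬ has v v

namespace IndexCodingProblem

variable {V : Type} (I : IndexCodingProblem V)

/-- Node `w` interferes with node `v`. -/
def Interferes (v w : V) : Prop := w ≠ v ∧ ¬ I.has v w

/-- The closed anti-outneighborhood of `v`: the node `v` and the nodes interfering with it. -/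
def closedAntiOut (v : V) : Set V := {w | w = v ∨ I.Interferes v w}

/-- A coloring is proper if no node shares its color with a node interfering with it. -/
def IsProper {n : ℕ} (color : V → Fin n) : Prop := ∀ v w, I.Interferes v w → color w ≠ color v

/-- The maximum number of colors in a closed anti-outneighborhood. -/
noncomputable def localColors [Fintype V] {n : ℕ} (color : V → Fin n) : ℕ :=
  Finset.univ.sup fun v => (color '' I.closedAntiOut v).ncard

/-- From the `r` broadcast bits `enc x` and its side information, each node recovers its packet. -/
def IsIndexCode {b r : ℕ} (enc : (V → Fin b → Bit) → (Fin r → Bit)) : Prop :=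
  ∀ v, ∃ dec : (Fin r → Bit) → ({w // I.has v w} → Fin b → Bit) → (Fin b → Bit),
    ∀ x, dec (enc x) (fun w => x w.1) = x v

end IndexCodingProblem

/-- The sum (exclusive or) of the packets of each color. -/
def colorSum {V : Type} [Fintype V] {n b : ℕ} (color : V → Fin n) (x : V → Fin b → Bit) :
    Fin n → Fin b → Bit :=
  fun q => ∑ v, if color v = q then x v else 0

/-! ### The placement on spaced sets of caches and the index coding problem it leaves -/

/-- The sets of `i` caches, any two of which are at cyclic distance at least `L`. -/
def spacedSets (K L i : ℕ) : Finset (Finset (Fin K)) :=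
  Finset.univ.filter fun s =>
    s.card = i ∧ ∀ a ∈ s, ∀ c ∈ s, a < c → (a : ℕ) + L ≤ c ∧ (c : ℕ) + L ≤ a + K

/-- The bit positions of a file that is split into subfiles of `b` bits, one for each spaced set. -/
abbrev SubfileBits (K L i b : ℕ) : Type := {s // s ∈ spacedSets K L i} × Fin b

/-- Of every file, the subfile of the spaced set `s` is stored in the caches belonging to `s`. -/
def spacedPlacement (N K L i b : ℕ) : Placement N K (SubfileBits K L i b) :=
  fun c => Finset.univ.filter fun x => c ∈ x.2.1.1

/-- The nodes `(p, s)`: user `p` requests the subfile of `s` of its file and reads none of the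
caches in `s`. -/
abbrev DeliveryNode (K L i : ℕ) : Type :=
  {v : Fin K × {s // s ∈ spacedSets K L i} // Disjoint v.2.1 (accessible K L v.1)}

/-- The index coding problem of the delivery phase: node `(p, s)` has the packet of node `(q, t)`
as side information if user `p` reads a cache in `t`. -/
def deliveryICP (K L i : ℕ) : IndexCodingProblem (DeliveryNode K L i) where
  has v w := ¬ Disjoint w.1.2.1 (accessible K L v.1.1)
  irrefl v h := h v.2

/-- The packets of the nodes when the file contents are `W` and the request profile is `d`. -/
def requestedPackets {N K L i b : ℕ} (d : Fin K → Fin N) (W : Library N (SubfileBits K L i b)) :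
    DeliveryNode K L i → Fin b → Bit :=
  fun v t => W (d v.1.1) (v.1.2, t)

end MultiAccess

/-! In a spaced set no user reads two caches, and each cache has `L` readers, so the set is out of
reach for exactly `K - iL` users. Rotation acts transitively on caches and on users, so double
counting gives each cache `i|Ŝ|/K` of the sets and hides `(K - iL)|Ŝ|/K` sets from each user
(`mul_card_containing`, `mul_card_unreached`). The first count is the memory `M|Ŝ|` divided by `N`.
Give every node its own color. The closed anti-outneighborhood of `(p, s)` consists of the nodes
`(q, t)` with `t` unreached by `p`; it has `(K - iL) * (K - iL)|Ŝ|/K = K(1 - LM/N)²|Ŝ|` elements,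
whatever the node. A Vandermonde code over `GaloisField 2 b` (`exists_mds_code`) resolves any `m`
unknown colors from `m` field symbols, hence serves every node. With `⌈K/L⌉` subfiles of each file
per cache, stored with stride `L`, each user reads everything (`hasScheme_full_access`). Memory
sharing makes the achievable pairs a convex set (`convex_achievable`), which gives the envelope. -/

namespace MultiAccess

/-! ### Cyclic distances -/

section Caches

variable {K L i : ℕ}

/-- The two inequalities for `a < c` bound the directed cyclic distances `c - a` and `a - c` in `Fin
K`. This form no longer depends on the order of `Fin K`, so rotations preserve it. -/
theorem mem_spacedSets {s : Finset (Fin K)} :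
    s ∈ spacedSets K L i ↔
      s.card = i ∧ ∀ a ∈ s, ∀ c ∈ s, a ≠ c → L ≤ ((c - a : Fin K) : ℕ) := by
  simp only [spacedSets, Finset.mem_filter, Finset.mem_univ, true_and]
  have key : ∀ a c : Fin K, a < c →
      ((c - a : Fin K) : ℕ) = c - a ∧ ((a - c : Fin K) : ℕ) = a + K - c := by
    intro a c h
    have hc := c.isLt
    have h' : (a : ℕ) < c := h
    refine ⟨Fin.sub_val_of_le h.le, ?_⟩
    rw [Fin.val_sub, Nat.mod_eq_of_lt (by omega)]
    omega
  refine and_congr_right fun _ => ⟨fun h a ha c hc hac => ?_, fun h a ha c hc hac => ?_⟩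
  · rcases lt_or_gt_of_ne hac with h1 | h1
    · have := h a ha c hc h1
      rw [(key a c h1).1]
      omega
    · have := h c hc a ha h1
      rw [(key c a h1).2]
      omega
  · have h1 := h a ha c hc hac.ne
    have h2 := h c hc a ha hac.ne'
    have h' : (a : ℕ) < c := hac
    rw [(key a c hac).1] at h1
    rw [(key a c hac).2] at h2
    omega

theorem spacedSets_nonempty (hL : 1 ≤ L) (hi : i * L ≤ K) : (spacedSets K L i).Nonempty := by
  have hlt : ∀ j : Fin i, (j : ℕ) * L + L ≤ i * L := fun j => by
    have := Nat.mul_le_mul_right L (Nat.succ_le_of_lt j.isLt)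
    rwa [Nat.succ_mul] at this
  -- The multiples `0, L, …, (i - 1)L`; the gap across the wrap-around is where `i * L ≤ K` enters.
  let f : Fin i → Fin K := fun j => ⟨j * L, by have := hlt j; omega⟩
  have hf : Function.Injective f := fun a c h =>
    Fin.ext (Nat.eq_of_mul_eq_mul_right hL (congrArg Fin.val h))
  refine ⟨Finset.univ.image f, ?_⟩
  simp only [spacedSets, Finset.mem_filter, Finset.mem_univ, true_and, Finset.mem_image,
    forall_exists_index, forall_apply_eq_imp_iff]
  refine ⟨by rw [Finset.card_image_of_injective _ hf, Finset.card_univ, Fintype.card_fin], ?_⟩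
  intro a c hac
  have h1 : (a : ℕ) * L < c * L := hac
  have h2 := Nat.mul_le_mul_right L (Nat.succ_le_of_lt (Nat.lt_of_mul_lt_mul_right h1))
  rw [Nat.succ_mul] at h2
  have := hlt c
  simp only [f]
  omega

theorem closedAntiOut_delivery (v : DeliveryNode K L i) :
    (deliveryICP K L i).closedAntiOut v =
      {w | Disjoint w.1.2.1 (accessible K L v.1.1)} := by
  ext w
  simp only [IndexCodingProblem.closedAntiOut, IndexCodingProblem.Interferes, deliveryICP,
    Set.mem_ofPred_eq, not_not]
  constructor
  · rintro (rfl | h)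
    · exact w.2
    · exact h.2
  · intro h
    by_cases hw : w = v
    · exact Or.inl hw
    · exact Or.inr ⟨hw, h⟩

/-- The spaced sets that contain the cache `c`. -/
def containing (K L i : ℕ) (c : Fin K) : Finset (Finset (Fin K)) :=
  (spacedSets K L i).filter fun s => c ∈ s

/-- The spaced sets that contain no cache read by user `p`. -/
def unreached (K L i : ℕ) (p : Fin K) : Finset (Finset (Fin K)) :=
  (spacedSets K L i).filter fun s => Disjoint s (accessible K L p)

theorem card_spacedPlacement {N b : ℕ} (c : Fin K) :
    (spacedPlacement N K L i b c).card = N * (containing K L i c).card * b := by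
  let e : Fin N × SubfileBits K L i b → Fin N × Finset (Fin K) × Fin b :=
    fun x => (x.1, x.2.1.1, x.2.2)
  have he : Function.Injective e := by
    rintro ⟨f, ⟨s, hs⟩, j⟩ ⟨g, ⟨t, ht⟩, l⟩ h
    simpa [e] using h
  have himage : (spacedPlacement N K L i b c).image e =
      Finset.univ ×ˢ (containing K L i c) ×ˢ Finset.univ := by
    ext ⟨f, s, j⟩
    simp [spacedPlacement, containing, e, and_comm]
  rw [← Finset.card_image_of_injective _ he, himage]
  simp [mul_assoc]

/-! ### Rotational symmetry and double counting -/

variable [NeZero K]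

theorem mem_accessible {k c : Fin K} (hLK : L ≤ K) :
    c ∈ accessible K L k ↔ ((c - k : Fin K) : ℕ) < L := by
  have hk := k.isLt
  have hc := c.isLt
  simp only [accessible, Finset.mem_filter, Finset.mem_univ, true_and]
  constructor
  · rintro ⟨j, hj, h⟩
    have : c = k + ⟨j, by omega⟩ := Fin.ext (by rw [h, Fin.val_add])
    rw [this, add_sub_cancel_left]
    exact hj
  · intro h
    refine ⟨_, h, ?_⟩
    rw [← Fin.val_add, add_sub_cancel]

/-- The rotation of a set of caches by `x`. -/
def rotate (x : Fin K) : Finset (Fin K) ≃ Finset (Fin K) :=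
  (Equiv.addRight x).finsetCongr

theorem mem_rotate {x c : Fin K} {s : Finset (Fin K)} : c ∈ rotate x s ↔ c - x ∈ s := by
  simp [rotate, Finset.mem_map_equiv, sub_eq_add_neg]

theorem rotate_mem_spacedSets {x : Fin K} {s : Finset (Fin K)} :
    rotate x s ∈ spacedSets K L i ↔ s ∈ spacedSets K L i := by
  have hcard : (rotate x s).card = s.card := by simp [rotate]
  rw [mem_spacedSets, mem_spacedSets, hcard]
  refine and_congr_right fun _ => ⟨fun h a ha c hc hac => ?_, fun h a ha c hc hac => ?_⟩
  · simpa using h (a + x) (by simpa [mem_rotate]) (c + x) (by simpa [mem_rotate]) (by simpa)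
  · simpa using h (a - x) (mem_rotate.1 ha) (c - x) (mem_rotate.1 hc) (by simpa)

theorem disjoint_rotate (hLK : L ≤ K) {x p : Fin K} {s : Finset (Fin K)} :
    Disjoint (rotate x s) (accessible K L p) ↔ Disjoint s (accessible K L (p - x)) := by
  simp only [Finset.disjoint_left, mem_rotate, mem_accessible hLK]
  constructor
  · intro h a ha
    simpa [sub_sub_eq_add_sub] using h (a := a + x) (by simpa)
  · intro h a ha
    simpa using h ha

theorem card_containing_eq (c : Fin K) :
    (containing K L i c).card = (containing K L i 0).card := by
  symm
  refine Finset.card_equiv (rotate c) fun s => ?_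
  simp [containing, rotate_mem_spacedSets, mem_rotate]

theorem card_unreached_eq (hLK : L ≤ K) (p : Fin K) :
    (unreached K L i p).card = (unreached K L i 0).card := by
  symm
  refine Finset.card_equiv (rotate p) fun s => ?_
  simp [unreached, rotate_mem_spacedSets, disjoint_rotate hLK]

theorem mul_card_containing (c : Fin K) :
    K * (containing K L i c).card = i * (spacedSets K L i).card := by
  have h := Finset.sum_card_bipartiteAbove_eq_sum_card_bipartiteBelow
    (fun (c : Fin K) (s : Finset (Fin K)) => c ∈ s) (s := Finset.univ) (t := spacedSets K L i)
  have h1 : ∀ c ∈ (Finset.univ : Finset (Fin K)), (Finset.bipartiteAbove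
      (fun (c : Fin K) (s : Finset (Fin K)) => c ∈ s) (spacedSets K L i) c).card =
      (containing K L i 0).card := fun c _ => card_containing_eq c
  have h2 : ∀ s ∈ spacedSets K L i, (Finset.bipartiteBelow
      (fun (c : Fin K) (s : Finset (Fin K)) => c ∈ s) Finset.univ s).card = i := by
    intro s hs
    rw [← (mem_spacedSets.1 hs).1]
    congr 1
    ext c
    simp [Finset.bipartiteBelow]
  rw [Finset.sum_congr rfl h1, Finset.sum_congr rfl h2] at h
  rw [card_containing_eq c]
  simpa [mul_comm] using h

theorem card_readers (hLK : L ≤ K) (c : Fin K) :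
    (Finset.univ.filter fun q => c ∈ accessible K L q).card = L := by
  have : (Finset.univ.filter fun q => c ∈ accessible K L q).card =
      (Finset.univ.filter fun x : Fin K => (x : ℕ) < L).card :=
    Finset.card_equiv (Equiv.subLeft c) fun q => by simp [mem_accessible hLK]
  rw [this, Fin.card_filter_val_lt, min_eq_right hLK]

theorem not_mem_accessible_of_spaced (hLK : L ≤ K) {s : Finset (Fin K)}
    (hs : s ∈ spacedSets K L i) {a c : Fin K} (ha : a ∈ s) (hc : c ∈ s) (hac : a ≠ c)
    {q : Fin K} (haq : a ∈ accessible K L q) : c ∉ accessible K L q := by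
  intro hcq
  rw [mem_accessible hLK] at haq hcq
  -- Two caches in the window of `q` differ by their offsets from `q`, so one directed distance is
  -- below `L`.
  have key : ∀ u v : Fin K, u ∈ s → v ∈ s → u ≠ v → ((u - q : Fin K) : ℕ) < L →
      ((v - q : Fin K) : ℕ) < L → ¬ u - q ≤ v - q := by
    intro u v hu hv huv h1 h2 h
    have h3 := (mem_spacedSets.1 hs).2 u hu v hv huv
    have h4 := Fin.sub_val_of_le h
    rw [sub_sub_sub_cancel_right] at h4
    omega
  rcases le_total (a - q) (c - q) with h | h
  · exact key a c ha hc hac haq hcq h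
  · exact key c a hc ha hac.symm hcq haq h

theorem card_users_disjoint (hLK : L ≤ K) {s : Finset (Fin K)} (hs : s ∈ spacedSets K L i) :
    (Finset.univ.filter fun q => Disjoint s (accessible K L q)).card = K - i * L := by
  have hU : (s.biUnion fun c => Finset.univ.filter fun q => c ∈ accessible K L q) =
      Finset.univ.filter fun q => ¬ Disjoint s (accessible K L q) := by
    ext q
    simp [Finset.not_disjoint_iff]
  have hcard : (Finset.univ.filter fun q => ¬ Disjoint s (accessible K L q)).card = i * L := by
    rw [← hU, Finset.card_biUnion]
    · rw [Finset.sum_congr rfl fun c _ => card_readers hLK c, Finset.sum_const,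
        (mem_spacedSets.1 hs).1, smul_eq_mul]
    · intro a ha c hc hac
      simp only [Function.onFun, Finset.disjoint_left, Finset.mem_filter, Finset.mem_univ,
        true_and]
      intro q hq
      exact not_mem_accessible_of_spaced hLK hs ha hc hac hq
  have := Finset.card_filter_add_card_filter_not (s := (Finset.univ : Finset (Fin K)))
    (fun q => Disjoint s (accessible K L q))
  rw [hcard, Finset.card_univ, Fintype.card_fin] at this
  omega

theorem mul_card_unreached (hLK : L ≤ K) (p : Fin K) :
    K * (unreached K L i p).card = (K - i * L) * (spacedSets K L i).card := by
  have h := Finset.sum_card_bipartiteAbove_eq_sum_card_bipartiteBelow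
    (fun (q : Fin K) (s : Finset (Fin K)) => Disjoint s (accessible K L q))
    (s := Finset.univ) (t := spacedSets K L i)
  have h1 : ∀ q ∈ (Finset.univ : Finset (Fin K)), (Finset.bipartiteAbove
      (fun (q : Fin K) (s : Finset (Fin K)) => Disjoint s (accessible K L q))
      (spacedSets K L i) q).card = (unreached K L i 0).card := fun q _ => card_unreached_eq hLK q
  have h2 : ∀ s ∈ spacedSets K L i, (Finset.bipartiteBelow
      (fun (q : Fin K) (s : Finset (Fin K)) => Disjoint s (accessible K L q))
      Finset.univ s).card = K - i * L := fun s hs => card_users_disjoint hLK hs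
  rw [Finset.sum_congr rfl h1, Finset.sum_congr rfl h2] at h
  rw [card_unreached_eq hLK p]
  simpa [mul_comm] using h

/-! ### Local colors of an injective coloring -/

theorem ncard_closedAntiOut_delivery (hLK : L ≤ K) (v : DeliveryNode K L i) :
    ((deliveryICP K L i).closedAntiOut v).ncard =
      (K - i * L) * (unreached K L i 0).card := by
  let e : DeliveryNode K L i → Σ _ : Finset (Fin K), Fin K := fun w => ⟨w.1.2.1, w.1.1⟩
  have he : Function.Injective e := by
    rintro ⟨⟨p, s⟩, hs⟩ ⟨⟨q, t⟩, ht⟩ h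
    simp only [e, Sigma.mk.injEq, heq_eq_eq] at h
    obtain ⟨h1, rfl⟩ := h
    obtain rfl := Subtype.ext h1
    rfl
  have himage : e '' (deliveryICP K L i).closedAntiOut v =
      ((unreached K L i v.1.1).sigma fun s =>
        Finset.univ.filter fun q => Disjoint s (accessible K L q) : Finset _) := by
    ext ⟨s, q⟩
    rw [closedAntiOut_delivery]
    simp only [unreached, Set.mem_image, Set.mem_ofPred_eq, Finset.coe_sigma, Set.mem_sigma_iff,
      Finset.mem_coe, Finset.mem_filter, Finset.mem_univ, true_and, e]
    constructor
    · rintro ⟨w, hw, h⟩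
      simp only [Sigma.mk.injEq, heq_eq_eq] at h
      obtain ⟨rfl, rfl⟩ := h
      exact ⟨⟨w.1.2.2, hw⟩, w.2⟩
    · rintro ⟨⟨h1, h2⟩, h3⟩
      exact ⟨⟨(q, ⟨s, h1⟩), h3⟩, h2, rfl⟩
  rw [← Set.ncard_image_of_injective _ he, himage, Set.ncard_coe_finset, Finset.card_sigma,
    Finset.sum_congr rfl fun s (hs : s ∈ unreached K L i v.1.1) =>
      card_users_disjoint hLK (Finset.mem_filter.1 hs).1, Finset.sum_const, smul_eq_mul, mul_comm, card_unreached_eq hLK]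

theorem localColors_delivery_of_injective (hLK : L ≤ K) {n : ℕ}
    {color : DeliveryNode K L i → Fin n} (hcolor : Function.Injective color) :
    (deliveryICP K L i).localColors color = (K - i * L) * (unreached K L i 0).card := by
  have h : ∀ v, (color '' (deliveryICP K L i).closedAntiOut v).ncard =
      (K - i * L) * (unreached K L i 0).card := fun v => by
    rw [Set.ncard_image_of_injective _ hcolor, ncard_closedAntiOut_delivery hLK]
  refine le_antisymm (Finset.sup_le fun v _ => (h v).le) ?_
  rcases (unreached K L i 0).eq_empty_or_nonempty with h0 | ⟨s, hs⟩
  -- Without unreached sets the claimed value is `0`, so the lower bound needs no node.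
  · simp [h0]
  · have hs' := Finset.mem_filter.1 hs
    rw [← h ⟨(0, ⟨s, hs'.1⟩), hs'.2⟩]
    exact Finset.le_sup (f := fun v => (color '' (deliveryICP K L i).closedAntiOut v).ncard)
      (Finset.mem_univ _)

theorem isProper_of_injective {V : Type} (I : IndexCodingProblem V) {n : ℕ} {color : V → Fin n}
    (hcolor : Function.Injective color) : I.IsProper color :=
  fun _ _ h hc => h.1 (hcolor hc)

end Caches

/-! ### Decoding -/

/-- Decodability means that the observed data determine the target; the decoder picks any compatible
input. All later decoding claims are proved in this form. -/
theorem exists_decoder_iff {X A S Y : Type*} [Nonempty Y] (f : X → A) (g : X → S) (h : X → Y) :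
    (∃ dec : A → S → Y, ∀ x, dec (f x) (g x) = h x) ↔
      ∀ x x', f x = f x' → g x = g x' → h x = h x' := by
  classical
  constructor
  · rintro ⟨dec, hdec⟩ x x' hf hg
    rw [← hdec x, ← hdec x', hf, hg]
  · intro H
    refine ⟨fun a s => if hx : ∃ x, f x = a ∧ g x = s then h hx.choose else Classical.arbitrary Y,
      fun x => ?_⟩
    have hx : ∃ y, f y = f x ∧ g y = g x := ⟨x, rfl, rfl⟩
    simp only [dif_pos hx]
    exact H _ _ hx.choose_spec.1 hx.choose_spec.2

theorem serves_iff {N K : ℕ} {B : Type} {L : ℕ} {C : Placement N K B} {d : Fin K → Fin N} {r : ℕ}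
    {enc : Library N B → (Fin r → Bit)} :
    Serves L C d enc ↔ ∀ (k : Fin K) (W W' : Library N B), enc W = enc W' →
      (∀ f x, Knows L C k (f, x) → W f x = W' f x) → W (d k) = W' (d k) := by
  refine forall_congr' fun k => ?_
  rw [exists_decoder_iff enc
    (fun W (x : {x : Fin N × B // Knows L C k x}) => W x.1.1 x.1.2) (fun W => W (d k))]
  simp only [funext_iff (f := fun _ : {x : Fin N × B // Knows L C k x} => _), Subtype.forall,
    Prod.forall]

theorem isIndexCode_iff {V : Type} (I : IndexCodingProblem V) {b r : ℕ}
    {enc : (V → Fin b → Bit) → (Fin r → Bit)} :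
    I.IsIndexCode enc ↔ ∀ (v : V) (x x' : V → Fin b → Bit), enc x = enc x' →
      (∀ w, I.has v w → x w = x' w) → x v = x' v := by
  refine forall_congr' fun v => ?_
  rw [exists_decoder_iff enc (fun x (w : {w // I.has v w}) => x w.1) (fun x => x v)]
  simp only [funext_iff (f := fun _ : {w // I.has v w} => _), Subtype.forall]

/-! ### Maximum distance separable codes over the field with two elements -/

theorem eq_zero_of_sum_mul_pow_eq_zero {E ι : Type*} [Field E] [Fintype ι] {α : ι → E}
    (hα : Function.Injective α) {y : ι → E} {m : ℕ} (T : Finset ι) (hT : T.card ≤ m)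
    (hy : ∀ q, q ∉ T → y q = 0) (hsum : ∀ j : Fin m, ∑ q, y q * α q ^ (j : ℕ) = 0) : y = 0 := by
  classical
  let e := T.equivFin.symm
  have hT0 : (fun l => y (e l)) = 0 := by
    refine Matrix.eq_zero_of_forall_pow_sum_mul_pow_eq_zero (f := fun l => α (e l))
      (hα.comp (Subtype.val_injective.comp e.injective)) fun j => ?_
    -- Only the first `T.card` of the `m` equations are used: they form a square Vandermonde system
    -- on `T`.
    rw [← hsum (Fin.castLE hT j), Equiv.sum_comp e fun q : T => y q * α q ^ (j : ℕ),
      Finset.sum_coe_sort T fun q => y q * α q ^ (j : ℕ)]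
    exact Finset.sum_subset (Finset.subset_univ T) fun q _ hq => by rw [hy q hq, zero_mul]
  funext q
  by_cases hq : q ∈ T
  · simpa [e] using congrFun hT0 (T.equivFin ⟨q, hq⟩)
  · exact hy q hq

/-- Packets become elements of the field of order `2 ^ b`, and the code sends the `m` power sums `∑
x q * α q ^ j` at distinct points `α q`; `n ≤ 2 ^ b` provides enough points. The identification of
packets with field elements only has to be linear over `Bit`. -/
theorem exists_mds_code {n m b : ℕ} (hb : b ≠ 0) (hn : n ≤ 2 ^ b) :
    ∃ code : (Fin n → Fin b → Bit) →ₗ[Bit] (Fin (m * b) → Bit),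
      ∀ (T : Finset (Fin n)) (x x' : Fin n → Fin b → Bit), T.card ≤ m →
        (∀ q, q ∉ T → x q = x' q) → code x = code x' → x = x' := by
  have : Finite (GaloisField 2 b) := Nat.finite_of_card_ne_zero (by
    rw [GaloisField.card 2 b hb]; positivity)
  have : Fintype (GaloisField 2 b) := Fintype.ofFinite _
  obtain ⟨α⟩ : Nonempty (Fin n ↪ GaloisField 2 b) := Function.Embedding.nonempty_of_card_le (by
    rw [← Nat.card_eq_fintype_card (α := GaloisField 2 b), GaloisField.card 2 b hb,
      Fintype.card_fin]
    exact hn)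
  have φ : (Fin b → Bit) ≃ₗ[Bit] GaloisField 2 b := LinearEquiv.ofFinrankEq _ _ (by
    rw [GaloisField.finrank 2 hb, Module.finrank_fin_fun])
  let ψ : (Fin m → Fin b → Bit) ≃ₗ[Bit] (Fin (m * b) → Bit) :=
    (LinearEquiv.curry Bit Bit (Fin m) (Fin b)).symm.trans
      (LinearEquiv.funCongrLeft Bit Bit finProdFinEquiv.symm)
  let γ : (Fin n → Fin b → Bit) →ₗ[Bit] (Fin m → Fin b → Bit) :=
    LinearMap.pi fun j => φ.symm.toLinearMap ∘ₗ
      ∑ q, LinearMap.mulRight Bit (α q ^ (j : ℕ)) ∘ₗ φ.toLinearMap ∘ₗ LinearMap.proj q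
  refine ⟨ψ.toLinearMap ∘ₗ γ, fun T x x' hT hx h => ?_⟩
  have hγ : γ (x - x') = 0 := by
    rw [map_sub, sub_eq_zero]
    exact ψ.injective h
  have hy : (fun q => φ ((x - x') q)) = 0 := by
    refine eq_zero_of_sum_mul_pow_eq_zero α.injective T hT (fun q hq => ?_) fun j => ?_
    · simp [hx q hq]
    · simpa [γ, ← map_sum, -map_sum] using congrFun hγ j
  rw [← sub_eq_zero]
  funext q
  exact (map_eq_zero_iff φ φ.injective).1 (congrFun hy q)

/-! ### Combining schemes -/

section Schemes

variable {N K L : ℕ} {B B' : Type}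

theorem HasScheme.congr (e : B ≃ B') {m r : ℕ} (h : HasScheme N K L B m r) :
    HasScheme N K L B' m r := by
  obtain ⟨C, hC, h⟩ := h
  let e' : Fin N × B ≃ Fin N × B' := (Equiv.refl _).prodCongr e
  refine ⟨fun c => (C c).map e'.toEmbedding, fun c => by simpa using hC c, fun d => ?_⟩
  obtain ⟨enc, henc⟩ := h d
  rw [serves_iff] at henc
  refine ⟨fun W => enc fun f x => W f (e x), serves_iff.2 fun k W W' hW hk => ?_⟩
  have := henc k _ _ hW fun f x ⟨c, hc, hx⟩ => hk f (e x)
    ⟨c, hc, Finset.mem_map.2 ⟨(f, x), hx, rfl⟩⟩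
  funext x
  simpa using congrFun this (e.symm x)

theorem HasScheme.sum {m r m' r' : ℕ} (h : HasScheme N K L B m r) (h' : HasScheme N K L B' m' r') :
    HasScheme N K L (B ⊕ B') (m + m') (r + r') := by
  obtain ⟨C, hC, h⟩ := h
  obtain ⟨C', hC', h'⟩ := h'
  let inl : Fin N × B ↪ Fin N × (B ⊕ B') := (Function.Embedding.refl _).prodMap .inl
  let inr : Fin N × B' ↪ Fin N × (B ⊕ B') := (Function.Embedding.refl _).prodMap .inr
  have hdisj : ∀ c, Disjoint ((C c).map inl) ((C' c).map inr) := fun c => by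
    simp [Finset.disjoint_left, inl, inr]
  refine ⟨fun c => ((C c).map inl).disjUnion ((C' c).map inr) (hdisj c), fun c => ?_, fun d => ?_⟩
  · rw [Finset.card_disjUnion, Finset.card_map, Finset.card_map]
    exact Nat.add_le_add (hC c) (hC' c)
  obtain ⟨enc, henc⟩ := h d
  obtain ⟨enc', henc'⟩ := h' d
  rw [serves_iff] at henc henc'
  refine ⟨fun W => Fin.append (enc fun f x => W f (.inl x)) (enc' fun f x => W f (.inr x)),
    serves_iff.2 fun k W W' hW hk => ?_⟩
  have h1 := henc k (fun f x => W f (.inl x)) (fun f x => W' f (.inl x))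
    (funext fun j => by simpa using congrFun hW (Fin.castAdd r' j))
    fun f x ⟨c, hc, hx⟩ => hk f (.inl x) ⟨c, hc, Finset.mem_disjUnion.2
      (.inl (Finset.mem_map.2 ⟨(f, x), hx, rfl⟩))⟩
  have h2 := henc' k (fun f x => W f (.inr x)) (fun f x => W' f (.inr x))
    (funext fun j => by simpa using congrFun hW (Fin.natAdd r j))
    fun f x ⟨c, hc, hx⟩ => hk f (.inr x) ⟨c, hc, Finset.mem_disjUnion.2
      (.inr (Finset.mem_map.2 ⟨(f, x), hx, rfl⟩))⟩
  funext x
  rcases x with x | x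
  · exact congrFun h1 x
  · exact congrFun h2 x

theorem HasScheme.add {F F' m r m' r' : ℕ} (h : HasScheme N K L (Fin F) m r)
    (h' : HasScheme N K L (Fin F') m' r') : HasScheme N K L (Fin (F + F')) (m + m') (r + r') :=
  (h.sum h').congr finSumFinEquiv

theorem hasScheme_uncached (F : ℕ) : HasScheme N K L (Fin F) 0 (K * F) := by
  refine ⟨fun _ => ∅, fun _ => le_rfl, fun d =>
    ⟨fun W j => W (d (finProdFinEquiv.symm j).1) (finProdFinEquiv.symm j).2,
      serves_iff.2 fun k W W' hW _ => funext fun x => ?_⟩⟩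
  simpa using congrFun hW (finProdFinEquiv (k, x))

/-! ### Achievable pairs -/

/-- The `F % S` leftover bits of each file are not cached but sent separately to each user. The
memory bound, which has no slack, is thus kept, and the extra rate at most `K * S / F` is absorbed
by `ε`. -/
theorem achievable_of_blocks {S μ ρ b₀ : ℕ} (hS : 0 < S)
    (h : ∀ b, b₀ ≤ b → HasScheme N K L (Fin (S * b)) (μ * b) (ρ * b)) :
    Achievable N K L (ρ / S) (μ / S) := by
  intro ε hε
  obtain ⟨F₁, hF₁⟩ := exists_nat_ge (K * S / ε)
  refine ⟨max F₁ (S * b₀), fun F hF => ?_⟩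
  have hF1 : (F₁ : ℝ) ≤ F := by exact_mod_cast (le_max_left _ _).trans hF
  have hb : b₀ ≤ F / S := (Nat.le_div_iff_mul_le hS).2 (by
    rw [mul_comm]; exact (le_max_right _ _).trans hF)
  have hS' : (0 : ℝ) < S := by exact_mod_cast hS
  have hdiv : (S : ℝ) * (F / S : ℕ) ≤ F := by exact_mod_cast Nat.mul_div_le F S
  have hmod : ((F % S : ℕ) : ℝ) ≤ S := by exact_mod_cast (Nat.mod_lt F hS).le
  have key : ∀ a : ℕ, (a : ℝ) * (F / S : ℕ) ≤ a / S * F := fun a => by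
    calc (a : ℝ) * (F / S : ℕ) = a / S * (S * (F / S : ℕ)) := by field_simp
      _ ≤ a / S * F := by gcongr
  refine ⟨μ * (F / S) + 0, ρ * (F / S) + K * (F % S), ?_, ?_, ?_⟩
  · push_cast
    simpa using key μ
  · have h1 : (K : ℝ) * S ≤ ε * F := by
      rw [div_le_iff₀ hε] at hF₁
      nlinarith
    have h2 : (K : ℝ) * (F % S : ℕ) ≤ K * S := by gcongr
    have := key ρ
    push_cast at *
    linarith
  · have := (h _ hb).add (hasScheme_uncached (F % S))
    rwa [Nat.div_add_mod] at this

/-- Provides the lower bound without which the infimum in `optimalRate` could be a default value. -/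
theorem Achievable.nonneg {R M : ℝ} (h : Achievable N K L R M) : 0 ≤ R := by
  refine le_of_forall_pos_le_add fun ε hε => ?_
  obtain ⟨F₀, h⟩ := h ε hε
  obtain ⟨m, r, -, hr, -⟩ := h (F₀ + 1) (Nat.le_succ _)
  have : (0 : ℝ) < (F₀ + 1 : ℕ) := by positivity
  exact nonneg_of_mul_nonneg_left ((Nat.cast_nonneg r).trans hr) this

theorem Achievable.optimalRate_le {R M : ℝ} (h : Achievable N K L R M) :
    optimalRate N K L M ≤ R :=
  csInf_le ⟨0, fun _ h' => Achievable.nonneg h'⟩ h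

theorem Achievable.combine {R R' M M' s t : ℝ} (hM : M' ≤ M) (hs : 0 < s) (ht : 0 < t)
    (hst : s + t = 1) (h : Achievable N K L R M) (h' : Achievable N K L R' M') :
    Achievable N K L (s * R + t * R') (s * M + t * M') := by
  intro ε hε
  obtain ⟨F₀, h⟩ := h (ε / 2) (by linarith)
  obtain ⟨F₀', h'⟩ := h' (ε / 2) (by linarith)
  obtain ⟨F₁, hF₁⟩ := exists_nat_ge ((F₀ + 1) / s)
  obtain ⟨F₂, hF₂⟩ := exists_nat_ge (F₀' / t)
  obtain ⟨F₃, hF₃⟩ := exists_nat_ge (|R - R'| / (ε / 2))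
  refine ⟨max F₁ (max F₂ F₃), fun F hF => ?_⟩
  rw [div_le_iff₀ (by positivity)] at hF₁ hF₂ hF₃
  simp only [max_le_iff] at hF
  have hF1 : (F₁ : ℝ) ≤ F := by exact_mod_cast hF.1
  have hF2 : (F₂ : ℝ) ≤ F := by exact_mod_cast hF.2.1
  have hF3 : (F₃ : ℝ) ≤ F := by exact_mod_cast hF.2.2
  -- Rounding down the share with the larger memory keeps the memory bound exact; the rate changes
  -- by at most `|R - R'|` bits, which `F₃` makes at most `ε / 2 * F`.
  set G := ⌊s * F⌋₊ with hG
  have hG1 : (G : ℝ) ≤ s * F := Nat.floor_le (by positivity)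
  have hG2 : s * F < G + 1 := Nat.lt_floor_add_one _
  have hGF : G ≤ F := by
    have : (G : ℝ) ≤ F := by nlinarith [Nat.cast_nonneg (α := ℝ) F]
    exact_mod_cast this
  obtain ⟨m, r, hm, hr, hscheme⟩ := h G (by
    have : (F₀ : ℝ) ≤ G := by nlinarith
    exact_mod_cast this)
  have hsub : ((F - G : ℕ) : ℝ) = F - G := Nat.cast_sub hGF
  obtain ⟨m', r', hm', hr', hscheme'⟩ := h' (F - G) (by
    have : (F₀' : ℝ) ≤ (F - G : ℕ) := by
      rw [hsub]
      nlinarith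
    exact_mod_cast this)
  rw [hsub] at hm' hr'
  obtain rfl : t = 1 - s := by linarith
  refine ⟨m + m', r + r', ?_, ?_, ?_⟩
  · push_cast
    nlinarith [mul_le_mul_of_nonneg_left hG1 (sub_nonneg.2 hM)]
  · have h1 : (R - R') * (G - s * F) ≤ ε / 2 * F := by
      have h2 : |G - s * F| ≤ 1 := abs_le.2 ⟨by linarith, by linarith⟩
      calc (R - R') * (G - s * F) ≤ |R - R'| * |G - s * F| := by
            rw [← abs_mul]; exact le_abs_self _
        _ ≤ |R - R'| * 1 := by gcongr
        _ ≤ ε / 2 * F := by nlinarith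
    push_cast
    linarith
  · have := hscheme.add hscheme'
    rwa [Nat.add_sub_cancel' hGF] at this

theorem convex_achievable (N K L : ℕ) : Convex ℝ {p : ℝ × ℝ | Achievable N K L p.2 p.1} := by
  rw [convex_iff_forall_pos]
  rintro ⟨M, R⟩ h ⟨M', R'⟩ h' s t hs ht hst
  rcases le_total M' M with hM | hM
  · exact Achievable.combine hM hs ht hst h h'
  · have := Achievable.combine hM ht hs ((add_comm t s).trans hst) h' h
    rwa [add_comm (t * _), add_comm (t * _)] at this

theorem achievable_lowerConvexEnvelope {P : Set (ℝ × ℝ)}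
    (hP : ∀ p ∈ P, Achievable N K L p.2 p.1) {M y : ℝ} (hM : (M, y) ∈ convexHull ℝ P) :
    Achievable N K L (lowerConvexEnvelope P M) M := by
  intro ε hε
  -- The infimum need not be attained: a hull point within `ε / 2` is enough. The given `y` only
  -- makes the set nonempty.
  obtain ⟨z, hz, hlt⟩ := exists_lt_of_csInf_lt (s := {y : ℝ | (M, y) ∈ convexHull ℝ P}) ⟨y, hM⟩
    (lt_add_of_pos_right _ (half_pos hε))
  obtain ⟨F₀, h⟩ := convexHull_min hP (convex_achievable N K L) hz (ε / 2) (half_pos hε)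
  refine ⟨F₀, fun F hF => ?_⟩
  obtain ⟨m, r, hm, hr, hscheme⟩ := h F hF
  refine ⟨m, r, hm, hr.trans ?_, hscheme⟩
  have : z + ε / 2 ≤ lowerConvexEnvelope P M + ε := by
    unfold lowerConvexEnvelope
    linarith
  gcongr

end Schemes

/-! ### Full access -/

/-- Steps of length `L` cannot jump over a window of length `L`. For `u ≥ L` the number of steps is
`(K - u) / L` rounded up, the first to reach `K`. -/
theorem exists_hit {L g u K : ℕ} (hL : 1 ≤ L) (hg : K ≤ g * L) (hu : u < K) :
    ∃ l < g, (u + l * L) % K < L := by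
  rcases lt_or_ge u L with h | h
  · refine ⟨0, Nat.pos_of_ne_zero ?_, ?_⟩
    · rintro rfl
      omega
    · rwa [zero_mul, add_zero, Nat.mod_eq_of_lt hu]
  · have h1 := Nat.div_add_mod (K - u + L - 1) L
    have h2 := Nat.mod_lt (K - u + L - 1) hL
    set l := (K - u + L - 1) / L
    have h3 : l * L < g * L := by
      rw [mul_comm l]
      omega
    refine ⟨l, Nat.lt_of_mul_lt_mul_right h3, ?_⟩
    have h4 : u + l * L = K + (u + L * l - K) := by
      rw [mul_comm l]
      omega
    rw [h4, Nat.add_mod_left]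
    exact (Nat.mod_le _ _).trans_lt (by omega)

theorem hasScheme_full_access {N K L g : ℕ} (hL : 1 ≤ L) (hLK : L ≤ K) (hg : K ≤ g * L) (b : ℕ) :
    HasScheme N K L (Fin (K * b)) (g * N * b) 0 := by
  have : NeZero K := ⟨by omega⟩
  suffices HasScheme N K L (Fin K × Fin b) (g * N * b) 0 from this.congr finProdFinEquiv
  -- Cache `c` holds the subfiles `c - l * L` with `l < g`, so subfile `s` lies in the caches `s + l
  -- * L`, one of which falls in the window of each user.
  let e : Fin K → Fin g × Fin N × Fin b → Fin N × (Fin K × Fin b) :=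
    fun c x => (x.2.1, (c - Fin.ofNat K (x.1 * L), x.2.2))
  refine ⟨fun c => Finset.univ.image (e c), fun c => ?_, fun d =>
    ⟨fun _ => Fin.elim0, serves_iff.2 fun k W W' _ hW => ?_⟩⟩
  · refine Finset.card_image_le.trans ?_
    simp [mul_assoc]
  · funext ⟨s, j⟩
    obtain ⟨l, hl, h⟩ := exists_hit hL hg (s - k).isLt
    refine hW _ _ ⟨s + Fin.ofNat K (l * L), ?_, ?_⟩
    · rw [mem_accessible hLK, add_sub_right_comm, Fin.val_add]
      simpa using h
    · exact Finset.mem_image.2 ⟨(⟨l, hl⟩, d k, j), Finset.mem_univ _, by simp [e]⟩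

theorem achievable_full_access {N K L g : ℕ} (hL : 1 ≤ L) (hLK : L ≤ K) (hg : K ≤ g * L) :
    Achievable N K L 0 (g * N / K) := by
  have := achievable_of_blocks (N := N) (K := K) (L := L) (S := K) (μ := g * N) (ρ := 0)
    (b₀ := 0) (by omega) fun b _ => by
      rw [zero_mul]
      exact hasScheme_full_access hL hLK hg b
  simpa using this

/-! ### Delivery over the spaced placement -/

section Delivery

variable {K L i n : ℕ}

theorem colorSum_apply_of_injective {V : Type} [Fintype V] {b : ℕ} {color : V → Fin n}
    (hcolor : Function.Injective color) (x : V → Fin b → Bit) (v : V) :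
    colorSum color x (color v) = x v := by
  classical
  simp [colorSum, hcolor.eq_iff]

theorem colorSum_eq_zero {V : Type} [Fintype V] {b : ℕ} {color : V → Fin n} (x : V → Fin b → Bit)
    {q : Fin n} (hq : ∀ v, color v ≠ q) : colorSum color x q = 0 := by
  simp [colorSum, hq]

/-- Take for `T` the colors on the closed anti-outneighborhood of `v`. Any other color is unused,
with sum zero, or carries a single packet that `v` already has. -/
theorem isIndexCode_of_mds {V : Type} [Fintype V] (I : IndexCodingProblem V) {b : ℕ}
    {color : V → Fin n} (hcolor : Function.Injective color)
    {r : ℕ} (code : (Fin n → Fin b → Bit) →ₗ[Bit] (Fin r → Bit))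
    (hcode : ∀ (T : Finset (Fin n)) (x x' : Fin n → Fin b → Bit), T.card ≤ I.localColors color →
        (∀ q, q ∉ T → x q = x' q) → code x = code x' → x = x') :
    I.IsIndexCode fun x => code (colorSum color x) := by
  classical
  rw [isIndexCode_iff]
  intro v x x' hx hv
  rw [← colorSum_apply_of_injective hcolor x, ← colorSum_apply_of_injective hcolor x']
  refine congrFun (hcode (Set.toFinite (color '' I.closedAntiOut v)).toFinset _ _ ?_ ?_ hx) _
  · rw [← Set.ncard_eq_toFinset_card]
    exact Finset.le_sup (f := fun v => (color '' I.closedAntiOut v).ncard) (Finset.mem_univ v)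
  · intro q hq
    by_cases h : ∃ w, color w = q
    · obtain ⟨w, rfl⟩ := h
      rw [colorSum_apply_of_injective hcolor, colorSum_apply_of_injective hcolor]
      refine hv w ?_
      by_contra hw
      refine hq ((Set.Finite.mem_toFinset _).2 ⟨w, ?_, rfl⟩)
      by_cases hwv : w = v
      · exact Or.inl hwv
      · exact Or.inr ⟨hwv, hw⟩
    · push Not at h
      rw [colorSum_eq_zero x h, colorSum_eq_zero x' h]

theorem serves_of_isIndexCode {N b r : ℕ} {enc : (DeliveryNode K L i → Fin b → Bit) → (Fin r → Bit)}
    (henc : (deliveryICP K L i).IsIndexCode enc) (d : Fin K → Fin N) :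
    Serves L (spacedPlacement N K L i b) d fun W => enc (requestedPackets d W) := by
  rw [isIndexCode_iff] at henc
  refine serves_iff.2 fun k W W' hW hk => ?_
  have hknown : ∀ f (s : {s // s ∈ spacedSets K L i}) j, ¬ Disjoint s.1 (accessible K L k) →
      W f (s, j) = W' f (s, j) := by
    intro f s j h
    obtain ⟨c, hcs, hck⟩ := Finset.not_disjoint_iff.1 h
    exact hk f (s, j) ⟨c, hck, by simpa [spacedPlacement] using hcs⟩
  funext ⟨s, j⟩
  by_cases h : Disjoint s.1 (accessible K L k)
  · exact congrFun (henc ⟨(k, s), h⟩ _ _ hW fun w hw => funext fun t => hknown _ _ _ hw) j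
  · exact hknown _ _ _ h

theorem exists_coloring_and_code [NeZero K] (hLK : L ≤ K) :
    ∃ (n : ℕ) (color : DeliveryNode K L i → Fin n),
      (deliveryICP K L i).IsProper color ∧
      (deliveryICP K L i).localColors color = (K - i * L) * (unreached K L i 0).card ∧
      ∃ b₀ : ℕ, ∀ b : ℕ, b₀ ≤ b →
        ∃ code : (Fin n → Fin b → Bit) →ₗ[Bit]
            (Fin ((deliveryICP K L i).localColors color * b) → Bit),
          (deliveryICP K L i).IsIndexCode fun x => code (colorSum color x) := by
  let color := Fintype.equivFin (DeliveryNode K L i)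
  refine ⟨_, color, isProper_of_injective _ color.injective,
    localColors_delivery_of_injective hLK color.injective,
    -- This bound gives both `b ≠ 0` and at most `2 ^ b` colors.
    Fintype.card (DeliveryNode K L i) + 1, fun b hb => ?_⟩
  obtain ⟨code, hcode⟩ := exists_mds_code (n := Fintype.card (DeliveryNode K L i))
    (m := (deliveryICP K L i).localColors color) (b := b) (by omega)
    ((Nat.le_succ _).trans (hb.trans Nat.lt_two_pow_self.le))
  exact ⟨code, isIndexCode_of_mds _ color.injective code hcode⟩

variable {N : ℕ}

theorem hasScheme_spaced [NeZero K] (hLK : L ≤ K) :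
    ∃ b₀ : ℕ, ∀ b : ℕ, b₀ ≤ b → HasScheme N K L (Fin ((spacedSets K L i).card * b))
      (N * (containing K L i 0).card * b) ((K - i * L) * (unreached K L i 0).card * b) := by
  obtain ⟨n, color, -, hlocal, b₀, h⟩ := exists_coloring_and_code (K := K) (L := L) (i := i) hLK
  refine ⟨b₀, fun b hb => ?_⟩
  obtain ⟨code, hcode⟩ := h b hb
  rw [← hlocal]
  refine HasScheme.congr (B := SubfileBits K L i b)
    (((Fintype.equivFinOfCardEq (by simp)).prodCongr (Equiv.refl _)).trans finProdFinEquiv)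
    ⟨spacedPlacement N K L i b, fun c => ?_, fun d => ⟨_, serves_of_isIndexCode hcode d⟩⟩
  rw [card_spacedPlacement, card_containing_eq]

theorem memory_eq [NeZero K] (c : Fin K) :
    (i : ℝ) * N / K * (spacedSets K L i).card = (N * (containing K L i c).card : ℕ) := by
  have hK : (K : ℝ) ≠ 0 := Nat.cast_ne_zero.2 (NeZero.ne K)
  have : (K : ℝ) * (containing K L i c).card = i * (spacedSets K L i).card := by
    exact_mod_cast mul_card_containing c
  push_cast
  field_simp
  linear_combination (-(N : ℝ)) * this

theorem rate_eq [NeZero K] (hN : N ≠ 0) (hLK : L ≤ K) (hi : i * L ≤ K) :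
    (K : ℝ) * (1 - L * ((i : ℝ) * N / K) / N) ^ 2 * (spacedSets K L i).card =
      ((K - i * L) * (unreached K L i 0).card : ℕ) := by
  have hK : (K : ℝ) ≠ 0 := Nat.cast_ne_zero.2 (NeZero.ne K)
  have hN' : (N : ℝ) ≠ 0 := Nat.cast_ne_zero.2 hN
  have : (K : ℝ) * (unreached K L i 0).card = (K - i * L) * (spacedSets K L i).card := by
    have := mul_card_unreached (i := i) hLK (0 : Fin K)
    rw [← @Nat.cast_inj ℝ] at this
    push_cast [Nat.cast_sub hi] at this
    exact this
  push_cast [Nat.cast_sub hi]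
  field_simp
  linear_combination (-((K : ℝ) - i * L)) * this

theorem achievable_spaced [NeZero K] (hN : N ≠ 0) (hL : 1 ≤ L) (hLK : L ≤ K) (hi : i * L ≤ K) :
    Achievable N K L (K * (1 - L * ((i : ℝ) * N / K) / N) ^ 2) ((i : ℝ) * N / K) := by
  have hS : 0 < (spacedSets K L i).card := (spacedSets_nonempty hL hi).card_pos
  have hS' : ((spacedSets K L i).card : ℝ) ≠ 0 := Nat.cast_ne_zero.2 hS.ne'
  obtain ⟨b₀, h⟩ := hasScheme_spaced (N := N) (i := i) hLK
  have := achievable_of_blocks hS h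
  rwa [← memory_eq, ← rate_eq hN hLK hi, mul_div_cancel_right₀ _ hS',
    mul_div_cancel_right₀ _ hS'] at this

theorem mul_le_of_le_floor (hL : 1 ≤ L) (hi : i ≤ ⌊(K : ℝ) / L⌋₊) : i * L ≤ K := by
  rw [Nat.floor_div_eq_div] at hi
  exact (Nat.le_div_iff_mul_le hL).1 hi

theorem le_ceil_mul (hL : 1 ≤ L) : K ≤ ⌈(K : ℝ) / L⌉₊ * L := by
  have h := Nat.le_ceil ((K : ℝ) / L)
  rw [div_le_iff₀ (by exact_mod_cast hL)] at h
  exact_mod_cast h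

theorem achievable_of_mem_cornerPoints [NeZero K] (hN : N ≠ 0) (hL : 1 ≤ L) (hLK : L ≤ K)
    {p : ℝ × ℝ} (hp : p ∈ cornerPoints N K L) : Achievable N K L p.2 p.1 := by
  rcases hp with ⟨i, hi, h1, h2⟩ | rfl
  · rw [h2, h1]
    exact achievable_spaced hN hL hLK (mul_le_of_le_floor hL hi)
  · exact achievable_full_access hL hLK (le_ceil_mul hL)

theorem exists_mem_convexHull_cornerPoints {M : ℝ} (h0 : 0 ≤ M)
    (hM : M ≤ (N : ℝ) / K * ⌈(K : ℝ) / L⌉₊) : ∃ y, (M, y) ∈ convexHull ℝ (cornerPoints N K L) := by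
  set A : ℝ := (⌈(K : ℝ) / L⌉₊ : ℝ) * N / K with hA
  have hM' : M ∈ segment ℝ 0 A := by
    rw [segment_eq_Icc (by positivity)]
    exact ⟨h0, hM.trans_eq (by rw [hA]; ring)⟩
  obtain ⟨s, t, hs, ht, hst, rfl⟩ := hM'
  -- The chord from the corner `i = 0`, which is `(0, K)`, to `(A, 0)` lies over all of `[0, A]`.
  refine ⟨s * K, segment_subset_convexHull (𝕜 := ℝ) (x := (0, (K : ℝ))) (y := (A, 0))
    (Or.inl ⟨0, Nat.zero_le _, by simp⟩) (Or.inr rfl) ⟨s, t, hs, ht, hst, ?_⟩⟩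
  simp

end Delivery

end MultiAccess

theorem theorem1 (N K L : ℕ) (hKN : K ≤ N) (hL : 1 ≤ L) (hLK : L ≤ K) :
    -- the corner points `M = iN/K`, `0 ≤ i ≤ ⌊K/L⌋`
    (∀ i : ℕ, i ≤ ⌊(K : ℝ) / L⌋₊ → ∀ M : ℝ, M = (i : ℝ) * N / K →
      MultiAccess.Achievable N K L (K * (1 - L * M / N) ^ 2) M ∧
      MultiAccess.optimalRate N K L M ≤ K * (1 - L * M / N) ^ 2) ∧
    -- the corner point `M = ⌈K/L⌉N/K`
    (∀ M : ℝ, M = (⌈(K : ℝ) / L⌉₊ : ℝ) * N / K →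
      MultiAccess.Achievable N K L 0 M ∧ MultiAccess.optimalRate N K L M ≤ 0) ∧
    -- memory sharing
    (∀ M : ℝ, 0 ≤ M → M ≤ (N : ℝ) / K * (⌈(K : ℝ) / L⌉₊ : ℝ) →
      MultiAccess.Achievable N K L
        (MultiAccess.lowerConvexEnvelope (MultiAccess.cornerPoints N K L) M) M ∧
      MultiAccess.optimalRate N K L M ≤
        MultiAccess.lowerConvexEnvelope (MultiAccess.cornerPoints N K L) M) ∧
    -- for `0 ≤ i ≤ ⌊K/L⌋` the rate is attained, for all large enough subfile sizes `b`, by the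
    -- spaced placement and a linear index code based on a proper coloring
    (∀ i : ℕ, i ≤ ⌊(K : ℝ) / L⌋₊ → ∀ M : ℝ, M = (i : ℝ) * N / K →
      (MultiAccess.spacedSets K L i).Nonempty ∧
      ∃ (n : ℕ) (color : MultiAccess.DeliveryNode K L i → Fin n),
        (MultiAccess.deliveryICP K L i).IsProper color ∧
        ((MultiAccess.deliveryICP K L i).localColors color : ℝ) =
          K * (1 - L * M / N) ^ 2 * ((MultiAccess.spacedSets K L i).card : ℝ) ∧
        ∃ b₀ : ℕ, ∀ b : ℕ, b₀ ≤ b →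
          (∀ c, ((MultiAccess.spacedPlacement N K L i b c).card : ℝ) ≤
            M * (((MultiAccess.spacedSets K L i).card : ℝ) * b)) ∧
          ∃ code : (Fin n → Fin b → MultiAccess.Bit) →ₗ[MultiAccess.Bit]
              (Fin ((MultiAccess.deliveryICP K L i).localColors color * b) → MultiAccess.Bit),
            (MultiAccess.deliveryICP K L i).IsIndexCode
              (fun x => code (MultiAccess.colorSum color x)) ∧
            ∀ d : Fin K → Fin N,
              MultiAccess.Serves L (MultiAccess.spacedPlacement N K L i b) d
                (fun W => code (MultiAccess.colorSum color
                  (MultiAccess.requestedPackets d W)))) := by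
  have : NeZero K := ⟨by omega⟩
  have hN : N ≠ 0 := by omega
  refine ⟨?_, ?_, ?_, ?_⟩
  · rintro i hi M rfl
    have h := MultiAccess.achievable_spaced hN hL hLK (MultiAccess.mul_le_of_le_floor hL hi)
    exact ⟨h, h.optimalRate_le⟩
  · rintro M rfl
    have h := MultiAccess.achievable_full_access (N := N) hL hLK (MultiAccess.le_ceil_mul hL)
    exact ⟨h, h.optimalRate_le⟩
  · intro M h0 hM
    obtain ⟨y, hy⟩ := MultiAccess.exists_mem_convexHull_cornerPoints h0 hM
    have h := MultiAccess.achievable_lowerConvexEnvelope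
      (fun p hp => MultiAccess.achievable_of_mem_cornerPoints hN hL hLK hp) hy
    exact ⟨h, h.optimalRate_le⟩
  · rintro i hi M rfl
    have hi' := MultiAccess.mul_le_of_le_floor hL hi
    obtain ⟨n, color, hproper, hlocal, b₀, h⟩ :=
      MultiAccess.exists_coloring_and_code (i := i) hLK
    refine ⟨MultiAccess.spacedSets_nonempty hL hi', n, color, hproper, ?_, b₀, fun b hb => ?_⟩
    · rw [hlocal, MultiAccess.rate_eq hN hLK hi']
    · obtain ⟨code, hcode⟩ := h b hb
      refine ⟨fun c => ?_, code, hcode, fun d => MultiAccess.serves_of_isIndexCode hcode d⟩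
      rw [MultiAccess.card_spacedPlacement, ← mul_assoc, MultiAccess.memory_eq c]
      push_cast
      exact le_rfl
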